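/- Let $G=(\mathcal V,\mathcal E)$ be a finite simple graph and let $t$ assign to every edge one of $K=2$ source symbols $W_1,W_2$. A *storage code* for $(G,t)$ consists of independent source symbols $W_1,W_2$, each uniform on a set of $2^{L_w}$ elements, and for every node $n\in\mathcal V$ a coded symbol $V_n$ that is a function of $(W_1,W_2)$ with values in a set of $2^{L_v}$ elements, such that $H(W_k\mid V_i,V_j)=0$ for every edge $\{i,j\}$ with $t(\{i,j\})=W_k$; its rate is $L_w/L_v$, where $L_w,L_v>0$ need not be integers. The *capacity* $C$ of $(G,t)$ is the supremum of the rates of all its storage codes. An edge associated with $W_k$ is a $W_k$-edge, and a $W_k$-path is a sequence of distinct connecting $W_k$-edges. A $W_k$-edge $\{i,j\}$ is *internal* if for some $k'\ne k$ there is a $W_{k'}$-path with end nodes $i$ and $j$; every such $W_{k'}$-path is called a *residing path* of $\{i,j\}$. A node is *$M$-color* if the edges at it are associated with exactly $M$ different source symbols. A $2$-color node is *special* if, for at least one $k$, all nodes connected to it through $W_k$-edges are $1$-color. **Theorem.** If $G$ contains exactly one internal edge and every residing path of that edge contains at least two special $2$-color nodes, then $C\ge 4/3$. -/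

import Mathlib

namespace StorageCodes

noncomputable section

/-! ### Graph notions

An instance is a simple graph `G` on the node set `V` with an edge labelling
`t : G.EdgeLabeling (Fin K)`; the label `k` of an edge means that the edge is associated with the
source symbol `W_k`. The `W_k`-edges are the edges of `t.labelGraph k`. -/

variable {V : Type*} {G : SimpleGraph V} {K : ℕ}

/-- The number of different source symbols associated with the edges at the node `v`. -/
def colorCount (t : G.EdgeLabeling (Fin K)) (v : V) : ℕ :=
  {k : Fin K | ∃ w, (t.labelGraph k).Adj v w}.ncard

/-- `v` is an `M`-color node. -/
def IsColorNode (t : G.EdgeLabeling (Fin K)) (M : ℕ) (v : V) : Prop :=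
  colorCount t v = M

/-- `v` is a `W_k`-special `2`-color node: a `2`-color node with at least one `W_k`-edge such that
all nodes connected to `v` through `W_k`-edges are `1`-color. -/
def IsSpecialAt (t : G.EdgeLabeling (Fin K)) (k : Fin K) (v : V) : Prop :=
  IsColorNode t 2 v ∧ (∃ w, (t.labelGraph k).Adj v w) ∧
    ∀ w, (t.labelGraph k).Adj v w → IsColorNode t 1 w

/-- `v` is a special `2`-color node. -/
def IsSpecial (t : G.EdgeLabeling (Fin K)) (v : V) : Prop :=
  ∃ k, IsSpecialAt t k v

/-- For a `W_k`-edge `{u, v}` and `k' ≠ k`, `p` is a residing `W_{k'}`-path of `{u, v}`: a sequence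
of distinct connecting `W_{k'}`-edges with end nodes `u` and `v`. -/
def IsResidingPath (t : G.EdgeLabeling (Fin K)) {k k' : Fin K} {u v : V}
    (_huv : (t.labelGraph k).Adj u v) (_hk : k' ≠ k) (p : (t.labelGraph k').Walk u v) : Prop :=
  p.IsTrail

/-- The edge `e` is internal: it is a `W_k`-edge `{u, v}` for some `k`, and it has a residing
`W_{k'}`-path for some `k' ≠ k`. -/
def IsInternal (t : G.EdgeLabeling (Fin K)) (e : Sym2 V) : Prop :=
  ∃ (u v : V) (k k' : Fin K) (huv : (t.labelGraph k).Adj u v) (hk : k' ≠ k)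
    (p : (t.labelGraph k').Walk u v), e = s(u, v) ∧ IsResidingPath t huv hk p

/-! ### Entropy of random variables on a finite uniform sample space -/

/-- The entropy, in bits, of a random variable `X` on the finite set `Ω` with the uniform
distribution. -/
def entropy {Ω A : Type*} [Fintype Ω] [Fintype A] (X : Ω → A) : ℝ :=
  ∑ a, Real.negMulLog ((Nat.card {ω // X ω = a} : ℝ) / (Fintype.card Ω : ℝ)) / Real.log 2

/-- The conditional entropy `H(X | Y) = H(X, Y) - H(Y)`, in bits. -/
def condEntropy {Ω A B : Type*} [Fintype Ω] [Fintype A] [Fintype B]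
    (X : Ω → A) (Y : Ω → B) : ℝ :=
  entropy (fun ω => (X ω, Y ω)) - entropy Y

/-! ### Storage codes and capacity -/

/-- A storage code. Each of the `K` source symbols takes `qW` values and each coded symbol takes
`qV` values. The `K` sources are independent and uniform, so that the sample space is
`Fin K → Fin qW` with the uniform distribution, and the coded symbols are functions of the sources.
For every `W_k`-edge `{u, v}` one has `H(W_k | V_u, V_v) = 0`. -/
structure StorageCode (t : G.EdgeLabeling (Fin K)) where
  /-- the number of values of a source symbol -/
  qW : ℕ
  /-- the number of values of a coded symbol -/
  qV : ℕ
  one_lt_qW : 1 < qW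
  one_lt_qV : 1 < qV
  /-- the coded symbols as functions of the source symbols -/
  enc : V → (Fin K → Fin qW) → Fin qV
  decodes : ∀ (k : Fin K) (u v : V), (t.labelGraph k).Adj u v →
    condEntropy (fun W : Fin K → Fin qW => W k) (fun W => (enc u W, enc v W)) = 0

/-- The rate `L_w / L_v`, where `L_w = log₂ qW` and `L_v = log₂ qV` are the sizes in bits of the
source symbols and of the coded symbols. -/
def StorageCode.rate {t : G.EdgeLabeling (Fin K)} (c : StorageCode t) : ℝ :=
  Real.logb 2 c.qW / Real.logb 2 c.qV

/-- The storage code capacity: the supremum of the rates of all storage codes (in the extended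
reals, since it is infinite for a graph without edges). -/
def capacity (t : G.EdgeLabeling (Fin K)) : EReal :=
  ⨆ c : StorageCode t, (c.rate : EReal)

end

end StorageCodes

namespace StorageCodes

/-! Let `k` be the label of the internal edge `{u, v}`. Read the sources `W k` and `W k'` as cubic
polynomials f and g over a large prime field. Four values determine a cubic and a node stores three
field symbols, so the rate is 4/3.

A 1-color node leaves its source undetermined only along a line, which one more generic equation
kills. A 2-color node mixes two values of f with two values of g. On a `W_k`-edge between two such
nodes the g-points must coincide, so that the interference cancels, and the four f-points must be
distinct; on a `W_{k'}`-edge the roles are exchanged. Hence g-points are attached to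
`W_k`-components and f-points to `W_{k'}`-components. The only clash is at `{u, v}`, whose ends
share a `W_{k'}`-component.

To resolve it, each `W_{k'}`-component gets four f-points, and a node of level l uses points l and l
+ 1; u needs level 0 and v level 2. A `W_k`-special node has only 1-color `W_k`-neighbours, for
which a single f-value suffices. It stores one f-value and two g-values, and can border both level l
and level l - 1, since these two windows share point l. The level counts such nodes on
`W_{k'}`-walks from u through 2-color nodes, and the hypothesis on residing paths forces it to be 2
at v. -/

/-- A random variable that is determined by `Y` has conditional entropy zero given `Y`. -/
theorem condEntropy_eq_zero_of_determined {Ω A B : Type*} [Fintype Ω] [Fintype A] [Fintype B]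
    (X : Ω → A) (Y : Ω → B) (h : ∀ ω ω', Y ω = Y ω' → X ω = X ω') : condEntropy X Y = 0 := by
  classical
  unfold condEntropy entropy
  rw [sub_eq_zero, Fintype.sum_prod_type_right]
  refine Finset.sum_congr rfl fun b _ => ?_
  by_cases hb : ∃ ω, Y ω = b
  · obtain ⟨ω, rfl⟩ := hb
    rw [Finset.sum_eq_single (X ω)]
    · have : ∀ ω', ((X ω', Y ω') = (X ω, Y ω)) ↔ Y ω' = Y ω := fun ω' =>
        ⟨fun e => (Prod.mk.inj e).2, fun e => Prod.ext (h _ _ e) e⟩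
      simp only [this]
    · intro a _ ha
      have : IsEmpty {ω' // (X ω', Y ω') = (a, Y ω)} :=
        ⟨fun ⟨ω', e⟩ => ha ((Prod.mk.inj e).1.symm.trans (h _ _ (Prod.mk.inj e).2))⟩
      rw [Nat.card_of_isEmpty]
      simp
    · simp
  · have h1 : IsEmpty {ω // Y ω = b} := ⟨fun ⟨ω, e⟩ => hb ⟨ω, e⟩⟩
    have h2 : ∀ a, IsEmpty {ω // (X ω, Y ω) = (a, b)} := fun a =>
      ⟨fun ⟨ω, e⟩ => hb ⟨ω, (Prod.mk.inj e).2⟩⟩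
    simp only [Nat.card_of_isEmpty]
    simp

/-- A family of linear encoders with four-dimensional sources and three-dimensional coded symbols
that decodes along every edge certifies that the capacity is at least `4 / 3`. -/
theorem le_capacity_of_linear {V : Type*} {G : SimpleGraph V} {t : G.EdgeLabeling (Fin 2)}
    (p : ℕ) [Fact p.Prime]
    (E : V → (Fin 2 → Fin 4 → ZMod p) →ₗ[ZMod p] (Fin 3 → ZMod p))
    (hE : ∀ (k : Fin 2) (u v : V), (t.labelGraph k).Adj u v →
      ∀ W, E u W = 0 → E v W = 0 → W k = 0) :
    ((4 / 3 : ℝ) : EReal) ≤ capacity t := by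
  have hp : 1 < p := (Fact.out : p.Prime).one_lt
  let eW : (Fin 4 → ZMod p) ≃ Fin (p ^ 4) := Fintype.equivFinOfCardEq (by simp [ZMod.card])
  let eV : (Fin 3 → ZMod p) ≃ Fin (p ^ 3) := Fintype.equivFinOfCardEq (by simp [ZMod.card])
  let c : StorageCode t :=
    { qW := p ^ 4
      qV := p ^ 3
      one_lt_qW := Nat.one_lt_pow (by norm_num) hp
      one_lt_qV := Nat.one_lt_pow (by norm_num) hp
      enc := fun v W => eV (E v fun j => eW.symm (W j))
      decodes := fun k u v huv => condEntropy_eq_zero_of_determined _ _ fun W W' h => by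
        obtain ⟨h1, h2⟩ := Prod.mk.inj h
        have h1 := sub_eq_zero.2 (eV.injective h1)
        have h2 := sub_eq_zero.2 (eV.injective h2)
        rw [← map_sub] at h1 h2
        exact eW.symm.injective (sub_eq_zero.1 (hE k u v huv _ h1 h2)) }
  have hr : c.rate = 4 / 3 := by
    have hl : Real.logb 2 p ≠ 0 :=
      (Real.logb_pos (by norm_num) (by exact_mod_cast hp)).ne'
    simp only [StorageCode.rate, c, Nat.cast_pow, Real.logb_pow]
    field_simp
    norm_num
  rw [← hr]
  exact le_iSup (fun c : StorageCode t => (c.rate : EReal)) c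

/-! ### Linear encoders over a field -/

section Encoders

variable {F : Type*} [Field F]

/-- The coefficient of degree `i` of the source `W j`. -/
def coeffSource (j : Fin 2) (i : Fin 4) : (Fin 2 → Fin 4 → F) →ₗ[F] F :=
  (LinearMap.proj i : (Fin 4 → F) →ₗ[F] F) ∘ₗ LinearMap.proj j

@[simp]
theorem coeffSource_apply (j : Fin 2) (i : Fin 4) (W : Fin 2 → Fin 4 → F) :
    coeffSource j i W = W j i := rfl

/-- The value at `x` of the cubic polynomial with coefficient vector `W j`. -/
def evalSource (j : Fin 2) (x : F) : (Fin 2 → Fin 4 → F) →ₗ[F] F :=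
  ∑ i : Fin 4, x ^ (i : ℕ) • coeffSource j i

theorem evalSource_apply (j : Fin 2) (x : F) (W : Fin 2 → Fin 4 → F) :
    evalSource j x W = ∑ i : Fin 4, W j i * x ^ (i : ℕ) := by
  simp [evalSource, LinearMap.sum_apply, mul_comm]

/-- A cubic polynomial with four distinct roots vanishes. -/
theorem source_eq_zero_of_four_roots {j : Fin 2} {W : Fin 2 → Fin 4 → F} {x : Fin 4 → F}
    (hx : Function.Injective x) (h : ∀ i, evalSource j (x i) W = 0) : W j = 0 :=
  Matrix.eq_zero_of_forall_index_sum_mul_pow_eq_zero hx fun i => by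
    rw [← evalSource_apply, h]

/-- The encoder of a one-color node: all of `W j` up to multiples of `(1, w, 0, 0)`. -/
def pureEnc (j : Fin 2) (w : F) : (Fin 2 → Fin 4 → F) →ₗ[F] (Fin 3 → F) :=
  LinearMap.pi ![coeffSource j 1 - w • coeffSource j 0,
    coeffSource j 2, coeffSource j 3]

/-- The encoder of a two-color node that mixes the two sources. -/
def mixedEnc (j j' : Fin 2) (x y x' y' z : F) : (Fin 2 → Fin 4 → F) →ₗ[F] (Fin 3 → F) :=
  LinearMap.pi ![evalSource j x + z • evalSource j y, evalSource j' x' + z • evalSource j' y',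
    evalSource j y + evalSource j' y']

/-- The encoder of a two-color node that stores one symbol of `W j` and two symbols of `W j'`. -/
def splitEnc (j j' : Fin 2) (a x' y' z : F) : (Fin 2 → Fin 4 → F) →ₗ[F] (Fin 3 → F) :=
  LinearMap.pi ![evalSource j a, evalSource j' x' + z • evalSource j' y', evalSource j' y']

theorem pureEnc_eq_zero {j : Fin 2} {w : F} {W : Fin 2 → Fin 4 → F} (h : pureEnc j w W = 0) :
    W j 1 = w * W j 0 ∧ W j 2 = 0 ∧ W j 3 = 0 := by
  have h0 := congrFun h 0
  have h1 := congrFun h 1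
  have h2 := congrFun h 2
  simp [pureEnc] at h0 h1 h2
  exact ⟨sub_eq_zero.1 h0, h1, h2⟩

theorem mixedEnc_eq_zero {j j' : Fin 2} {x y x' y' z : F} {W : Fin 2 → Fin 4 → F}
    (h : mixedEnc j j' x y x' y' z W = 0) :
    evalSource j x W + z * evalSource j y W = 0 ∧
      evalSource j' x' W + z * evalSource j' y' W = 0 ∧
      evalSource j y W + evalSource j' y' W = 0 := by
  have h0 := congrFun h 0
  have h1 := congrFun h 1
  have h2 := congrFun h 2
  simp [mixedEnc] at h0 h1 h2
  exact ⟨h0, h1, h2⟩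

theorem splitEnc_eq_zero {j j' : Fin 2} {a x' y' z : F} {W : Fin 2 → Fin 4 → F}
    (h : splitEnc j j' a x' y' z W = 0) :
    evalSource j a W = 0 ∧ evalSource j' x' W = 0 ∧ evalSource j' y' W = 0 := by
  have h0 := congrFun h 0
  have h1 := congrFun h 1
  have h2 := congrFun h 2
  simp [splitEnc] at h0 h1 h2
  exact ⟨h0, by simpa [h2] using h1, h2⟩

theorem source_eq_zero_of_pure_pure {j : Fin 2} {w w' : F} {W : Fin 2 → Fin 4 → F} (hw : w ≠ w')
    (h : pureEnc j w W = 0) (h' : pureEnc j w' W = 0) : W j = 0 := by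
  obtain ⟨h1, h2, h3⟩ := pureEnc_eq_zero h
  obtain ⟨h1', -, -⟩ := pureEnc_eq_zero h'
  have h0 : W j 0 = 0 := by
    have : (w - w') * W j 0 = 0 := by rw [sub_mul, ← h1, ← h1', sub_self]
    exact (mul_eq_zero.1 this).resolve_left (sub_ne_zero.2 hw)
  funext i
  fin_cases i <;> simp [h0, h1, h2, h3]

/-- The vectors `W j` killed by `pureEnc` form the line spanned by the polynomial `1 + w X`; `hw`
says that the second functional does not vanish on it. -/
theorem source_eq_zero_of_pure_eval {j : Fin 2} {w x y z : F} {W : Fin 2 → Fin 4 → F}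
    (hw : 1 + w * x + z * (1 + w * y) ≠ 0) (h : pureEnc j w W = 0)
    (h' : evalSource j x W + z * evalSource j y W = 0) : W j = 0 := by
  obtain ⟨h1, h2, h3⟩ := pureEnc_eq_zero h
  have h0 : W j 0 = 0 := by
    have : W j 0 * (1 + w * x + z * (1 + w * y)) = 0 := by
      rw [← h']
      simp [evalSource_apply, Fin.sum_univ_four, h1, h2, h3]
      ring
    exact (mul_eq_zero.1 this).resolve_right hw
  funext i
  fin_cases i <;> simp [h0, h1, h2, h3]

/-- Two independent combinations of `a` and `b` that vanish force `a` and `b` to vanish. -/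
theorem eq_zero_of_two_combinations {a b z z' : F} (hz : z ≠ z') (h : a + z * b = 0)
    (h' : a + z' * b = 0) : a = 0 ∧ b = 0 := by
  have hb : b = 0 := by
    have : (z - z') * b = 0 := by linear_combination h - h'
    exact (mul_eq_zero.1 this).resolve_left (sub_ne_zero.2 hz)
  exact ⟨by simpa [hb] using h, hb⟩

end Encoders

/-! ### From levels to a code -/

/-- Natural numbers that determine a linear storage code of rate `4 / 3`: `X` is the set of nodes
that store one symbol of `W k` only, and `lev` says which interference space of its component a node
uses. -/
theorem le_capacity_of_levels {V : Type*} [Finite V] {G : SimpleGraph V}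
    {t : G.EdgeLabeling (Fin 2)} {k k' : Fin 2} (hk : k' ≠ k) (cf cg lev : V → ℕ) (X : Set V)
    (hlev : ∀ n, lev n ≤ 2)
    (hX : ∀ n m, n ∈ X → (t.labelGraph k).Adj n m → ¬ ∀ j, ∃ w, (t.labelGraph j).Adj m w)
    (hcg : ∀ n m, (t.labelGraph k).Adj n m → cg n = cg m)
    (hcf : ∀ n m, (t.labelGraph k').Adj n m → cf n = cf m)
    (hcg' : ∀ n m, (t.labelGraph k').Adj n m → cg n ≠ cg m)
    (hcf' : ∀ n m, (t.labelGraph k).Adj n m → cf n = cf m →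
      lev n = 0 ∧ lev m = 2 ∨ lev n = 2 ∧ lev m = 0)
    (hlev_eq : ∀ n m, (t.labelGraph k').Adj n m → (∀ j, ∃ w, (t.labelGraph j).Adj n w) →
      (∀ j, ∃ w, (t.labelGraph j).Adj m w) → n ∉ X → m ∉ X → lev n = lev m)
    (hlev_X : ∀ n m, (t.labelGraph k').Adj n m → (∀ j, ∃ w, (t.labelGraph j).Adj n w) →
      (∀ j, ∃ w, (t.labelGraph j).Adj m w) → n ∈ X → m ∉ X →
      lev n = lev m ∨ lev n = lev m + 1) :
    ((4 / 3 : ℝ) : EReal) ≤ capacity t := by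
  classical
  obtain ⟨z, hz⟩ := exists_injective_nat V
  obtain ⟨N, hN⟩ : ∃ N, ∀ n, 4 * cf n + 3 ≤ N ∧ 2 * cg n + 1 ≤ N ∧ z n + 1 ≤ N := by
    obtain ⟨N, hN⟩ := (Set.finite_range fun n => 4 * cf n + 3 + (2 * cg n + 1) + (z n + 1)).bddAbove
    refine ⟨N, fun n => ?_⟩
    have := hN ⟨n, rfl⟩
    simp only at this
    omega
  -- The cube exceeds every `1 + w * x + z * (1 + w * y)` with entries at most `N`, so these
  -- positive integers stay nonzero mod `p`.
  obtain ⟨p, hpN, hp⟩ := Nat.exists_infinite_primes ((N + 2) ^ 3)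
  have : Fact p.Prime := ⟨hp⟩
  have hNp : N < p := by
    have : N + 2 ≤ (N + 2) ^ 3 := Nat.le_self_pow (by norm_num) _
    omega
  have hcast : ∀ {a b : ℕ}, a ≤ N → b ≤ N → a ≠ b → (a : ZMod p) ≠ b := fun ha hb hab h =>
    hab (by
      have := (ZMod.natCast_eq_natCast_iff' _ _ _).1 h
      rwa [Nat.mod_eq_of_lt (ha.trans_lt hNp), Nat.mod_eq_of_lt (hb.trans_lt hNp)] at this)
  have hpos : ∀ {w x y z : ℕ}, w ≤ N → x ≤ N → y ≤ N → z ≤ N →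
      (1 + w * x + z * (1 + w * y) : ZMod p) ≠ 0 := by
    intro w x y z hw hx hy hz h
    have hle : 1 + w * x + z * (1 + w * y) ≤ 1 + N * N + N * (1 + N * N) := by gcongr
    have h0 : ((1 + w * x + z * (1 + w * y) : ℕ) : ZMod p) = 0 := by push_cast; exact h
    have := Nat.le_of_dvd (by omega) ((ZMod.natCast_eq_zero_iff _ _).1 h0)
    nlinarith [Nat.zero_le N]
  have hpos' : ∀ {w x : ℕ}, w ≤ N → x ≤ N →
      (1 + w * x + 0 * (1 + w * x) : ZMod p) ≠ 0 := fun hw hx => by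
    simpa using hpos hw hx hx (Nat.zero_le N)
  have hroots : ∀ {j : Fin 2} {W : Fin 2 → Fin 4 → ZMod p} (l : Fin 4 → ℕ), (∀ i, l i ≤ N) →
      Function.Injective l → (∀ i, evalSource j (l i : ZMod p) W = 0) → W j = 0 :=
    fun l hl hinj => source_eq_zero_of_four_roots fun a b hab =>
      by_contra fun hne => hcast (hl a) (hl b) (hinj.ne hne) hab
  have hzne : ∀ {n m : V}, n ≠ m → ((z n + 1 : ℕ) : ZMod p) ≠ ((z m + 1 : ℕ) : ZMod p) :=
    fun {n m} hnm => hcast (hN n).2.2 (hN m).2.2 fun h => hnm (hz (by omega))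
  have hz0 : ∀ n, ((z n + 1 : ℕ) : ZMod p) ≠ 0 := fun n => by
    simpa using hcast (hN n).2.2 (Nat.zero_le N) (Nat.succ_ne_zero _)
  let two : V → Prop := fun n => ∀ j, ∃ w, (t.labelGraph j).Adj n w
  -- Since `lev n ≤ 2`, the points `a n` and `b n` lie in the block of four belonging to `cf n`;
  -- levels 0 and 2 give disjoint pairs.
  let a : V → ℕ := fun n => 4 * cf n + lev n
  let b : V → ℕ := fun n => 4 * cf n + (lev n + 1)
  let a' : V → ℕ := fun n => 2 * cg n
  let b' : V → ℕ := fun n => 2 * cg n + 1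
  let ζ : V → ℕ := fun n => z n + 1
  have ha : ∀ n, a n ≤ N := fun n => by have := hN n; have := hlev n; simp only [a]; omega
  have hb : ∀ n, b n ≤ N := fun n => by have := hN n; have := hlev n; simp only [b]; omega
  have ha' : ∀ n, a' n ≤ N := fun n => by have := hN n; simp only [a']; omega
  have hb' : ∀ n, b' n ≤ N := fun n => (hN n).2.1
  have hζ : ∀ n, ζ n ≤ N := fun n => (hN n).2.2
  let E : V → (Fin 2 → Fin 4 → ZMod p) →ₗ[ZMod p] (Fin 3 → ZMod p) := fun n =>
    if two n then
      if n ∈ X then splitEnc k k' (a n : ZMod p) (a' n : ZMod p) (b' n : ZMod p) (ζ n : ZMod p)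
      else mixedEnc k k' (a n : ZMod p) (b n : ZMod p) (a' n : ZMod p) (b' n : ZMod p)
        (ζ n : ZMod p)
    else if ∃ w, (t.labelGraph k).Adj n w then pureEnc k (ζ n : ZMod p)
    else pureEnc k' (ζ n : ZMod p)
  have hfin : ∀ j : Fin 2, j = k ∨ j = k' := by omega
  have hE_one : ∀ {n j}, ¬ two n → (∃ w, (t.labelGraph j).Adj n w) →
      E n = pureEnc j (ζ n : ZMod p) := by
    intro n j hn hj
    rcases hfin j with rfl | rfl
    · simp only [E, if_neg hn, if_pos hj]
    · have : ¬ ∃ w, (t.labelGraph k).Adj n w := fun h => hn fun i => by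
        rcases hfin i with rfl | rfl
        · exact h
        · exact hj
      simp only [E, if_neg hn, if_neg this]
  have hE_split : ∀ {n}, two n → n ∈ X → E n = splitEnc k k' (a n : ZMod p) (a' n : ZMod p)
      (b' n : ZMod p) (ζ n : ZMod p) := fun h h' => by simp only [E, if_pos h, if_pos h']
  have hE_mixed : ∀ {n}, two n → n ∉ X → E n = mixedEnc k k' (a n : ZMod p) (b n : ZMod p)
      (a' n : ZMod p) (b' n : ZMod p) (ζ n : ZMod p) := fun h h' => by
    simp only [E, if_pos h, if_neg h']
  have hone_two : ∀ {j n m W}, (t.labelGraph j).Adj n m → ¬ two n → two m →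
      E n W = 0 → E m W = 0 → W j = 0 := by
    intro j n m W hnm hn hm h h'
    rw [hE_one hn ⟨m, hnm⟩] at h
    by_cases hmX : m ∈ X
    · rw [hE_split hm hmX] at h'
      obtain ⟨h1, h2, -⟩ := splitEnc_eq_zero h'
      rcases hfin j with rfl | rfl
      · exact source_eq_zero_of_pure_eval (hpos' (hζ n) (ha m)) h (by rw [h1, zero_mul, add_zero])
      · exact source_eq_zero_of_pure_eval (hpos' (hζ n) (ha' m)) h (by rw [h2, zero_mul, add_zero])
    · rw [hE_mixed hm hmX] at h'
      obtain ⟨h1, h2, -⟩ := mixedEnc_eq_zero h'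
      rcases hfin j with rfl | rfl
      · exact source_eq_zero_of_pure_eval (hpos (hζ n) (ha m) (hb m) (hζ m)) h h1
      · exact source_eq_zero_of_pure_eval (hpos (hζ n) (ha' m) (hb' m) (hζ m)) h h2
  have hroots' : ∀ {n m W}, (t.labelGraph k').Adj n m → evalSource k' (a' n : ZMod p) W = 0 →
      evalSource k' (b' n : ZMod p) W = 0 → evalSource k' (a' m : ZMod p) W = 0 →
      evalSource k' (b' m : ZMod p) W = 0 → W k' = 0 := by
    intro n m W hnm h1 h2 h3 h4
    refine hroots ![a' n, b' n, a' m, b' m] ?_ ?_ ?_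
    · simp [Fin.forall_fin_succ, ha', hb']
    · have := hcg' n m hnm
      intro i j hij
      fin_cases i <;> fin_cases j <;> simp [a', b'] at hij ⊢ <;> omega
    · simp [Fin.forall_fin_succ, h1, h2, h3, h4]
  have hsplit_mixed : ∀ {n m W}, (t.labelGraph k').Adj n m → two n → two m → n ∈ X → m ∉ X →
      E n W = 0 → E m W = 0 → W k' = 0 := by
    intro n m W hnm hn hm hnX hmX h h'
    rw [hE_split hn hnX] at h
    rw [hE_mixed hm hmX] at h'
    obtain ⟨h1, h2, h3⟩ := splitEnc_eq_zero h
    obtain ⟨h4, h5, h6⟩ := mixedEnc_eq_zero h'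
    -- The single f-value stored at `n` is at one of the two f-points of `m`. If that point is `a
    -- m`, the nonzero multiplier of `m` transfers the vanishing to `b m`.
    have h7 : evalSource k (b m : ZMod p) W = 0 := by
      rcases hlev_X n m hnm hn hm hnX hmX with e | e
      · have : a n = a m := by simp only [a, hcf n m hnm, e]
        rw [this] at h1
        rw [h1, zero_add] at h4
        exact (mul_eq_zero.1 h4).resolve_left (hz0 m)
      · have : a n = b m := by simp only [a, b, hcf n m hnm, e]
        rwa [this] at h1
    rw [h7, zero_add] at h6
    rw [h6, mul_zero, add_zero] at h5
    exact hroots' hnm h2 h3 h5 h6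
  refine le_capacity_of_linear p E fun j n m hnm W h h' => ?_
  by_cases hn : two n
  · by_cases hm : two m
    · rcases hfin j with rfl | rfl
      · have hnX : n ∉ X := fun hnX => hX n m hnX hnm hm
        have hmX : m ∉ X := fun hmX => hX m n hmX hnm.symm hn
        rw [hE_mixed hn hnX] at h
        rw [hE_mixed hm hmX] at h'
        obtain ⟨h1, h2, h3⟩ := mixedEnc_eq_zero h
        obtain ⟨h4, h5, h6⟩ := mixedEnc_eq_zero h'
        have ea : a' n = a' m := by simp only [a', hcg n m hnm]
        have eb : b' n = b' m := by simp only [b', hcg n m hnm]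
        rw [← ea, ← eb] at h5
        rw [← eb] at h6
        -- Aligned interference: both ends combine the same two g-values, with different
        -- multipliers.
        obtain ⟨-, h7⟩ := eq_zero_of_two_combinations (hzne hnm.ne) h2 h5
        rw [h7, add_zero] at h3 h6
        rw [h3, mul_zero, add_zero] at h1
        rw [h6, mul_zero, add_zero] at h4
        refine hroots ![a n, b n, a m, b m] ?_ ?_ ?_
        · simp [Fin.forall_fin_succ, ha, hb]
        · have := hcf' n m hnm
          have := hlev n
          have := hlev m
          intro i j hij
          fin_cases i <;> fin_cases j <;> simp [a, b] at hij ⊢ <;> omega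
        · simp [Fin.forall_fin_succ, h1, h3, h4, h6]
      · by_cases hnX : n ∈ X
        · by_cases hmX : m ∈ X
          · rw [hE_split hn hnX] at h
            rw [hE_split hm hmX] at h'
            obtain ⟨-, h1, h2⟩ := splitEnc_eq_zero h
            obtain ⟨-, h3, h4⟩ := splitEnc_eq_zero h'
            exact hroots' hnm h1 h2 h3 h4
          · exact hsplit_mixed hnm hn hm hnX hmX h h'
        · by_cases hmX : m ∈ X
          · exact hsplit_mixed hnm.symm hm hn hmX hnX h' h
          · rw [hE_mixed hn hnX] at h
            rw [hE_mixed hm hmX] at h'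
            obtain ⟨h1, h2, h3⟩ := mixedEnc_eq_zero h
            obtain ⟨h4, h5, h6⟩ := mixedEnc_eq_zero h'
            have el := hlev_eq n m hnm hn hm hnX hmX
            have ea : a n = a m := by simp only [a, hcf n m hnm, el]
            have eb : b n = b m := by simp only [b, hcf n m hnm, el]
            rw [← ea, ← eb] at h4
            rw [← eb] at h6
            obtain ⟨-, h7⟩ := eq_zero_of_two_combinations (hzne hnm.ne) h1 h4
            rw [h7, zero_add] at h3 h6
            rw [h3, mul_zero, add_zero] at h2
            rw [h6, mul_zero, add_zero] at h5
            exact hroots' hnm h2 h3 h5 h6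
    · exact hone_two hnm.symm hm hn h' h
  · by_cases hm : two m
    · exact hone_two hnm hn hm h h'
    · rw [hE_one hn ⟨m, hnm⟩] at h
      rw [hE_one hm ⟨n, hnm.symm⟩] at h'
      exact source_eq_zero_of_pure_pure (hzne hnm.ne) h h'

/-! ### Counting special nodes along walks -/

/-- A node is `2`-color with respect to two source symbols iff it has edges of both labels. -/
theorem isColorNode_two_iff {V : Type*} {G : SimpleGraph V} {t : G.EdgeLabeling (Fin 2)} {v : V} :
    IsColorNode t 2 v ↔ ∀ j, ∃ w, (t.labelGraph j).Adj v w := by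
  unfold IsColorNode colorCount
  constructor
  · intro h j
    have : {k : Fin 2 | ∃ w, (t.labelGraph k).Adj v w} = Set.univ :=
      Set.eq_of_subset_of_ncard_le (Set.subset_univ _) (by simp [h, Set.ncard_univ])
    exact this.ge (Set.mem_univ j)
  · intro h
    have : {k : Fin 2 | ∃ w, (t.labelGraph k).Adj v w} = Set.univ := Set.eq_univ_of_forall h
    simp [this, Set.ncard_univ]

/-- `n` is reached from `u` by a walk of `H` whose nodes all lie in `S`. -/
def ReachesWithin {V : Type*} (H : SimpleGraph V) (S : Set V) (u n : V) : Prop :=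
  ∃ w : H.Walk u n, ∀ m ∈ w.support, m ∈ S

theorem ReachesWithin.step {V : Type*} {H : SimpleGraph V} {S : Set V} {u n m : V}
    (h : ReachesWithin H S u n) (hnm : H.Adj n m) (hm : m ∈ S) : ReachesWithin H S u m := by
  obtain ⟨w, hw⟩ := h
  refine ⟨w.concat hnm, fun x hx => ?_⟩
  rw [SimpleGraph.Walk.support_concat, List.mem_append, List.mem_singleton] at hx
  rcases hx with hx | rfl
  · exact hw x hx
  · exact hm

theorem ReachesWithin.mem {V : Type*} {H : SimpleGraph V} {S : Set V} {u n : V}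
    (h : ReachesWithin H S u n) : n ∈ S := by
  obtain ⟨w, hw⟩ := h
  exact hw n w.end_mem_support

theorem ReachesWithin.mono {V : Type*} {H : SimpleGraph V} {S T : Set V} {u n : V}
    (hST : S ⊆ T) (h : ReachesWithin H S u n) : ReachesWithin H T u n := by
  obtain ⟨w, hw⟩ := h
  exact ⟨w, fun m hm => hST (hw m hm)⟩

/-- The nodes of `T` outside `X`, together with `x` if it lies in `T`. -/
def allowing {V : Type*} (T X : Set V) (x : V) : Set V := {m | m ∈ T ∧ (m ∈ X → m = x)}

open Classical in
/-- The least number of nodes of `X` on a walk from `u` to `n` within `T`, cut off at `2`. -/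
noncomputable def level {V : Type*} (H : SimpleGraph V) (T X : Set V) (u n : V) : ℕ :=
  if ReachesWithin H (T \ X) u n then 0
  else if ∃ x, ReachesWithin H (allowing T X x) u n then 1 else 2

theorem diff_subset_allowing {V : Type*} (T X : Set V) (x : V) : T \ X ⊆ allowing T X x :=
  fun _ hm => ⟨hm.1, fun h => absurd h hm.2⟩

theorem level_le_two {V : Type*} (H : SimpleGraph V) (T X : Set V) (u n : V) :
    level H T X u n ≤ 2 := by
  unfold level
  split_ifs <;> omega

theorem level_eq_of_adj {V : Type*} {H : SimpleGraph V} {T X : Set V} {u n m : V}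
    (hnm : H.Adj n m) (hn : n ∈ T \ X) (hm : m ∈ T \ X) : level H T X u n = level H T X u m := by
  have h0 : ReachesWithin H (T \ X) u n ↔ ReachesWithin H (T \ X) u m :=
    ⟨fun h => h.step hnm hm, fun h => h.step hnm.symm hn⟩
  have h1 : ∀ x, ReachesWithin H (allowing T X x) u n ↔ ReachesWithin H (allowing T X x) u m :=
    fun x => ⟨fun h => h.step hnm (diff_subset_allowing T X x hm),
      fun h => h.step hnm.symm (diff_subset_allowing T X x hn)⟩
  classical
  exact if_congr h0 rfl (if_congr (exists_congr h1) rfl rfl)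

/-- A walk ending at `n` meets `n ∈ X`, so its level is at least 1. Stepping from `m` to `n` adds at
most one node of `X`, and stepping back adds none. -/
theorem level_of_adj_mem {V : Type*} {H : SimpleGraph V} {T X : Set V} {u n m : V}
    (hnm : H.Adj n m) (hnT : n ∈ T) (hnX : n ∈ X) (hm : m ∈ T \ X) :
    level H T X u n = level H T X u m ∨ level H T X u n = level H T X u m + 1 := by
  have h0 : ¬ ReachesWithin H (T \ X) u n := fun h => h.mem.2 hnX
  have h1 : (∃ x, ReachesWithin H (allowing T X x) u n) →
      ∃ x, ReachesWithin H (allowing T X x) u m :=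
    fun ⟨x, h⟩ => ⟨x, h.step hnm (diff_subset_allowing T X x hm)⟩
  have h2 : ReachesWithin H (T \ X) u m → ∃ x, ReachesWithin H (allowing T X x) u n :=
    fun h => ⟨n, (h.mono (diff_subset_allowing T X n)).step hnm.symm ⟨hnT, fun _ => rfl⟩⟩
  unfold level
  split_ifs <;> first | omega | (exfalso; tauto)

/-- A special node with a `W_{k'}`-edge to a `2`-color node is `W_k`-special. -/
theorem isSpecialAt_of_isSpecial_of_adj {V : Type*} {G : SimpleGraph V}
    {t : G.EdgeLabeling (Fin 2)} {k k' : Fin 2} (hk : k' ≠ k) {a b : V}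
    (h : IsSpecial t a) (hab : (t.labelGraph k').Adj a b) (hb : IsColorNode t 2 b) :
    IsSpecialAt t k a := by
  obtain ⟨j, hj⟩ := h
  have : j = k ∨ j = k' := by omega
  rcases this with rfl | rfl
  · exact hj
  · have := hj.2.2 b hab
    unfold IsColorNode at this hb
    omega

end StorageCodes

/-! ### The capacity bound -/

open StorageCodes in
theorem theorem4 {V : Type*} [Fintype V] (G : SimpleGraph V) (t : G.EdgeLabeling (Fin 2))
    (hone : ∃! e : Sym2 V, StorageCodes.IsInternal t e)
    (hspecial : ∀ (u v : V) (k k' : Fin 2) (huv : (t.labelGraph k).Adj u v) (hk : k' ≠ k)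
      (p : (t.labelGraph k').Walk u v), StorageCodes.IsResidingPath t huv hk p →
        ∃ a ∈ p.support, ∃ b ∈ p.support,
          a ≠ b ∧ StorageCodes.IsSpecial t a ∧ StorageCodes.IsSpecial t b) :
    ((4 / 3 : ℝ) : EReal) ≤ StorageCodes.capacity t := by
  classical
  obtain ⟨e, ⟨u, v, k, k', huv, hk, p, rfl, hp⟩, huniq⟩ := hone
  have hinternal : ∀ {n m : V} {j j' : Fin 2}, (t.labelGraph j).Adj n m → j' ≠ j →
      (t.labelGraph j').Reachable n m → s(n, m) = s(u, v) := by
    intro n m j j' hnm hj ⟨w⟩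
    exact huniq _ ⟨n, m, j, j', hnm, hj, w.bypass, rfl, w.bypass_isPath.isTrail⟩
  have hlabel : ¬ (t.labelGraph k').Adj u v := fun h => by
    obtain ⟨h1, e1⟩ := (SimpleGraph.EdgeLabeling.labelGraph_adj _ _).1 huv
    obtain ⟨h2, e2⟩ := (SimpleGraph.EdgeLabeling.labelGraph_adj _ _).1 h
    exact hk (e2.symm.trans e1)
  let T : Set V := {n | ∀ j, ∃ w, (t.labelGraph j).Adj n w}
  let X : Set V := {n | IsSpecialAt t k n}
  have hfin : ∀ j : Fin 2, j = k ∨ j = k' := by omega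
  have hend : ∀ {n m : V}, (t.labelGraph k).Adj n m → (t.labelGraph k').Walk n m → n ∈ T := by
    intro n m hnm w j
    rcases hfin j with rfl | rfl
    · exact ⟨m, hnm⟩
    · cases w with
      | nil => exact absurd rfl hnm.ne
      | cons h _ => exact ⟨_, h⟩
  have huT : u ∈ T := hend huv p
  have hvT : v ∈ T := hend huv.symm p.reverse
  have hXadj : ∀ n m, n ∈ X → (t.labelGraph k).Adj n m → m ∉ T := by
    intro n m hn hnm hm
    have h1 := hn.2.2 m hnm
    have h2 := isColorNode_two_iff.2 hm
    unfold IsColorNode at h1 h2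
    omega
  have huX : u ∉ X := fun h => hXadj u v h huv hvT
  have hlu : level (t.labelGraph k') T X u u = 0 := by
    rw [level, if_pos]
    exact ⟨.nil, fun m hm => by
      rw [SimpleGraph.Walk.support_nil, List.mem_singleton] at hm
      exact hm ▸ ⟨huT, huX⟩⟩
  -- Such a walk would shorten to a residing path whose special nodes all equal `x`, but there are
  -- two of them.
  have hnot : ¬ ∃ x, ReachesWithin (t.labelGraph k') (allowing T X x) u v := by
    rintro ⟨x, w, hw⟩
    obtain ⟨a, ha, b, hb, hab, hsa, hsb⟩ :=
      hspecial u v k k' huv hk w.bypass w.bypass_isPath.isTrail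
    have key : ∀ c ∈ w.bypass.support, IsSpecial t c → c = x := by
      intro c hc hs
      have hcw := w.support_bypass_subset_support hc
      refine (hw c hcw).2 ?_
      -- A neighbour on the walk is 2-color, so the special node `c` can only be `W_k`-special, that
      -- is, in `X`.
      obtain ⟨d, hd, hcd⟩ : ∃ d ∈ w.support, (t.labelGraph k').Adj c d := by
        obtain ⟨e, he, hce⟩ := (SimpleGraph.Walk.mem_support_iff_exists_mem_edges_of_not_nil
          (SimpleGraph.Walk.not_nil_of_ne huv.ne)).1 hcw
        obtain ⟨d, rfl⟩ := hce
        exact ⟨d, w.snd_mem_support_of_mem_edges he, w.adj_of_mem_edges he⟩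
      exact isSpecialAt_of_isSpecial_of_adj hk hs hcd (isColorNode_two_iff.2 (hw d hd).1)
    exact hab ((key a ha hsa).trans (key b hb hsb).symm)
  have hlv : level (t.labelGraph k') T X u v = 2 := by
    rw [level, if_neg, if_neg hnot]
    exact fun h => hnot ⟨u, h.mono (diff_subset_allowing T X u)⟩
  obtain ⟨cf, hcf⟩ := exists_injective_nat (t.labelGraph k').ConnectedComponent
  obtain ⟨cg, hcg⟩ := exists_injective_nat (t.labelGraph k).ConnectedComponent
  refine le_capacity_of_levels hk (fun n => cf ((t.labelGraph k').connectedComponentMk n))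
    (fun n => cg ((t.labelGraph k).connectedComponentMk n)) (level (t.labelGraph k') T X u) X
    (level_le_two _ _ _ _) hXadj ?_ ?_ ?_ ?_ ?_ ?_
  · exact fun n m h => congrArg cg (SimpleGraph.ConnectedComponent.sound h.reachable)
  · exact fun n m h => congrArg cf (SimpleGraph.ConnectedComponent.sound h.reachable)
  -- A `W_{k'}`-edge inside one `W_k`-component would be internal, hence equal to `{u, v}`, which
  -- has label `k`.
  · intro n m h he
    have := hinternal h hk.symm (SimpleGraph.ConnectedComponent.exact (hcg he))
    rcases Sym2.eq_iff.1 this with ⟨rfl, rfl⟩ | ⟨rfl, rfl⟩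
    · exact hlabel h
    · exact hlabel h.symm
  · intro n m h he
    have := hinternal h hk (SimpleGraph.ConnectedComponent.exact (hcf he))
    rcases Sym2.eq_iff.1 this with ⟨rfl, rfl⟩ | ⟨rfl, rfl⟩
    · exact Or.inl ⟨hlu, hlv⟩
    · exact Or.inr ⟨hlv, hlu⟩
  · exact fun n m h hn hm hnX hmX => level_eq_of_adj h ⟨hn, hnX⟩ ⟨hm, hmX⟩
  · exact fun n m h hn hm hnX hmX => level_of_adj_mem h hn hnX ⟨hm, hmX⟩
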